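/- Let $n\ge 1$, let $E\subset\mathbb R^n$ be a compact set, let $K={\rm conv}(E)$ be its convex hull, and assume that the Lebesgue measure ${\rm vol}(K)$ is positive. Notation. Let $\Pi_1(\mathbb R^n)$ be the space of real polynomials in $n$ variables of degree at most $1$, and let $C(E)$ be the space of continuous functions $E\to\mathbb R$ with the uniform norm. For a nondegenerate $n$-dimensional simplex $S$ with vertices $x^{(1)},\dots,x^{(n+1)}\in E$, the interpolation projector $P_S:C(E)\to\Pi_1(\mathbb R^n)$ with nodes $x^{(j)}$ is determined by $P_Sf(x^{(j)})=f(x^{(j)})$, $1\le j\le n+1$, and $\|P_S\|_E$ denotes its norm as an operator from $C(E)$ to $C(E)$. Let $\theta_n(E)$ be the minimum of $\|P_S\|_E$ over all nondegenerate simplices $S$ with vertices in $E$. For $A\in\{E,K\}$ let ${\rm simp}_n(A)$ be the maximum volume of a nondegenerate simplex with vertices in $A$. Let $\chi_n(t)=\frac{1}{2^n n!}\frac{d^n}{dt^n}(t^2-1)^n$ be the standardized Legendre polynomial of degree $n$, and let $\chi_n^{-1}:[1,\infty)\to[1,\infty)$ be the inverse of the (increasing, bijective) function $\chi_n:[1,\infty)\to[1,\infty)$.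 Theorem. The minimum $\theta_n(E)$ and the maxima ${\rm simp}_n(E)$, ${\rm simp}_n(K)$ exist (are attained), and $${\rm simp}_n(E)={\rm simp}_n(K)>0,\qquad \frac{{\rm vol}(K)}{{\rm simp}_n(E)}\ge 1,\qquad \theta_n(E)\ \ge\ \chi_n^{-1}\!\left(\frac{{\rm vol}(K)}{{\rm simp}_n(E)}\right).$$ -/

import Mathlib

open MeasureTheory

/-- The standardized Legendre polynomial of degree `n`, by Rodrigues' formula:
`χₙ(t) = (1 / (2ⁿ n!)) · (dⁿ/dtⁿ) (t² - 1)ⁿ`. -/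
noncomputable def legendre (n : ℕ) : Polynomial ℝ :=
  Polynomial.C (1 / (2 ^ n * (n.factorial : ℝ))) *
    Polynomial.derivative^[n] ((Polynomial.X ^ 2 - 1) ^ n)

theorem legendre_eval (n : ℕ) (t : ℝ) :
    (legendre n).eval t = 1 / 2 ^ n *
      ∑ i ∈ Finset.range (n + 1), (n.choose i : ℝ) ^ 2 * (t - 1) ^ i * (t + 1) ^ (n - i) := by
  have h : ((Polynomial.X ^ 2 - 1) ^ n : Polynomial ℝ)
      = (Polynomial.X - Polynomial.C 1) ^ n * (Polynomial.X + Polynomial.C 1) ^ n := by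
    rw [← mul_pow]; congr 1; simp; ring
  rw [legendre, h, Polynomial.iterate_derivative_mul]
  simp only [Polynomial.iterate_derivative_X_sub_pow, Polynomial.iterate_derivative_X_add_pow,
    Polynomial.eval_mul, Polynomial.eval_C, Polynomial.eval_finsetSum]
  rw [Finset.mul_sum, Finset.mul_sum]
  refine Finset.sum_congr rfl fun i hi => ?_
  have hin : i ≤ n := Nat.lt_succ_iff.mp (Finset.mem_range.mp hi)
  have h1 : ((n.descFactorial (n - i) : ℕ) : ℝ) * (n.descFactorial i : ℕ)
      = n.choose i * n.factorial := by
    have e1 := Nat.factorial_mul_descFactorial hin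
    have e2 := Nat.descFactorial_eq_factorial_mul_choose n (n - i)
    rw [Nat.choose_symm hin] at e2
    rw [e2]
    have : n.factorial = (n - i).factorial * n.descFactorial i := e1.symm
    rw [this]; push_cast; ring
  have hf : (n.factorial : ℝ) ≠ 0 := by positivity
  simp only [nsmul_eq_mul, Polynomial.eval_mul, Polynomial.eval_pow,
    Polynomial.eval_sub, Polynomial.eval_add, Polynomial.eval_X, Polynomial.eval_C,
    Polynomial.eval_natCast, Nat.sub_sub_self hin]
  calc _ = 1 / (2 ^ n * (n.factorial : ℝ)) * (n.choose i *
        ((((n.descFactorial (n - i) : ℕ) : ℝ) * (n.descFactorial i : ℕ))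
        * ((t - 1) ^ i * (t + 1) ^ (n - i)))) := by ring
    _ = _ := by rw [h1]; field_simp

theorem legendre_strictMonoOn (n : ℕ) (hn : 1 ≤ n) :
    StrictMonoOn (fun t : ℝ => (legendre n).eval t) (Set.Ici 1) := by
  intro s hs t ht hst
  rw [Set.mem_Ici] at hs ht
  simp only [legendre_eval]
  refine mul_lt_mul_of_pos_left ?_ (by positivity)
  refine Finset.sum_lt_sum (fun i _ => ?_) ⟨0, by simp, ?_⟩
  · have h0 : 0 ≤ s - 1 := by linarith
    have h1 : 0 ≤ s + 1 := by linarith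
    gcongr
  · have h1 : 0 ≤ s + 1 := by linarith
    simpa using pow_lt_pow_left₀ (by linarith : s + 1 < t + 1) h1 (by omega)

/-- For `n ≥ 1` the function `χₙ` is a bijection of `[1, ∞)` onto `[1, ∞)`. -/
theorem legendre_bijOn (n : ℕ) (hn : 1 ≤ n) :
    Set.BijOn (fun t : ℝ => (legendre n).eval t) (Set.Ici 1) (Set.Ici 1) := by
  have hmono := legendre_strictMonoOn n hn
  have h1 : (legendre n).eval 1 = 1 := by
    rw [legendre_eval, Finset.sum_range_succ']
    norm_num
  refine ⟨fun t ht => ?_, hmono.injOn, fun s hs => ?_⟩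
  · have := hmono.monotoneOn (Set.mem_Ici.mpr le_rfl) ht ht
    simpa [h1] using this
  · rw [Set.mem_Ici] at hs
    have hbig : s ≤ (legendre n).eval (2 * s) := by
      rw [legendre_eval]
      have hle : (2 * s + 1) ^ n ≤ ∑ i ∈ Finset.range (n + 1),
          (n.choose i : ℝ) ^ 2 * (2 * s - 1) ^ i * (2 * s + 1) ^ (n - i) := by
        have hnn : ∀ i ∈ Finset.range (n + 1),
            0 ≤ (n.choose i : ℝ) ^ 2 * (2 * s - 1) ^ i * (2 * s + 1) ^ (n - i) := by
          intro i _
          have a : 0 ≤ 2 * s - 1 := by linarith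
          have b : 0 ≤ 2 * s + 1 := by linarith
          positivity
        simpa using Finset.single_le_sum hnn (by simp : 0 ∈ Finset.range (n + 1))
      calc s ≤ s ^ n := le_self_pow₀ hs (by omega)
        _ = 1 / 2 ^ n * (2 * s) ^ n := by rw [mul_pow]; field_simp
        _ ≤ 1 / 2 ^ n * (2 * s + 1) ^ n := by gcongr; linarith
        _ ≤ _ := by gcongr
    obtain ⟨t, ht, hts⟩ := intermediate_value_Icc (by linarith : (1 : ℝ) ≤ 2 * s)
      ((legendre n).continuous.continuousOn) ⟨by rw [h1]; exact hs, hbig⟩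
    exact ⟨t, ht.1, hts⟩

/-- `χₙ⁻¹`, the inverse of the function `χₙ` on `[1, ∞)` (for `n ≥ 1` and arguments in
`[1, ∞)`, see `legendre_bijOn`). -/
noncomputable def legendreInv (n : ℕ) : ℝ → ℝ :=
  Function.invFunOn (fun t : ℝ => (legendre n).eval t) (Set.Ici 1)

/-- `legendreInv` is a two-sided inverse of `χₙ : [1, ∞) → [1, ∞)` for `n ≥ 1`. -/
theorem legendreInv_invOn (n : ℕ) (hn : 1 ≤ n) :
    Set.InvOn (legendreInv n) (fun t : ℝ => (legendre n).eval t) (Set.Ici 1) (Set.Ici 1) :=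
  (legendre_bijOn n hn).invOn_invFunOn

/-- The volumes of the nondegenerate `n`-dimensional simplices with vertices in `A ⊆ ℝⁿ`. -/
def simplexVolumes {n : ℕ} (A : Set (EuclideanSpace ℝ (Fin n))) : Set ℝ :=
  {v | ∃ S : Affine.Simplex ℝ (EuclideanSpace ℝ (Fin n)) n,
    (∀ j, S.points j ∈ A) ∧ v = volume.real (convexHull ℝ (Set.range S.points))}

/-- `simpₙ(A)`: the maximal volume of a nondegenerate simplex with vertices in `A`. -/
noncomputable def simpVol {n : ℕ} (A : Set (EuclideanSpace ℝ (Fin n))) : ℝ :=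
  sSup (simplexVolumes A)

/-- `P : C(E) → C(E)` is the linear interpolation projector whose nodes are the vertices of the
nondegenerate simplex `S`: every `P f` is the restriction to `E` of a polynomial in `n` variables
of degree at most `1` that takes the same values as `f` at the vertices of `S`. -/
def IsInterpolationProjector {n : ℕ}
    (E : TopologicalSpace.Compacts (EuclideanSpace ℝ (Fin n)))
    (S : Affine.Simplex ℝ (EuclideanSpace ℝ (Fin n)) n)
    (P : C(E, ℝ) →L[ℝ] C(E, ℝ)) : Prop :=
  (∀ j, S.points j ∈ E) ∧
  ∀ f : C(E, ℝ), ∃ p ∈ MvPolynomial.restrictTotalDegree (Fin n) ℝ 1,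
    (∀ y : E, P f y = MvPolynomial.eval (fun i => (y : EuclideanSpace ℝ (Fin n)) i) p) ∧
    ∀ (y : E) (j : Fin (n + 1)), (y : EuclideanSpace ℝ (Fin n)) = S.points j →
      MvPolynomial.eval (fun i => (y : EuclideanSpace ℝ (Fin n)) i) p = f y

/-- The operator norms `‖P‖_E` (for the uniform norm on `C(E)`) of all linear interpolation
projectors with nodes in `E`. -/
def projectorNorms {n : ℕ} (E : TopologicalSpace.Compacts (EuclideanSpace ℝ (Fin n))) : Set ℝ :=
  {r | ∃ (S : Affine.Simplex ℝ (EuclideanSpace ℝ (Fin n)) n) (P : C(E, ℝ) →L[ℝ] C(E, ℝ)),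
    IsInterpolationProjector E S P ∧ r = ‖P‖}

/-- `θₙ(E)`: the minimal norm of a linear interpolation projector with nodes in `E`. -/
noncomputable def theta {n : ℕ} (E : TopologicalSpace.Compacts (EuclideanSpace ℝ (Fin n))) : ℝ :=
  sInf (projectorNorms E)

/-! In barycentric coordinates `λⱼ` of `S`, the projector is `P f = ∑ f(xⱼ) λⱼ`, so `‖P‖` is the
maximum over `E` of `∑ |λⱼ|`. With `t = ‖P‖`, convexity puts all of `K` in `{∑ |λⱼ| ≤ t}`. Since `∑
λⱼ = 1`, the negative parts there sum to at most `(t-1)/2` and the positive parts to at most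
`(t+1)/2`. Splitting by sign pattern bounds the volume of this body by `vol(S) χₙ(t)`, the binomial
sum being the Leibniz expansion of Rodrigues' formula. Hence `vol(K) ≤ vol(S) χₙ(‖P‖)`
(`volume_convexHull_le`), and `vol(S) ≤ simpₙ(E)` gives the bound on `θₙ(E)`.

The same inequality keeps simplices with bounded `‖P‖` away from degeneracy. There `‖P‖` is a
quotient of continuous functions of the vertices (`IsInterpolationProjector.norm_eq`), so
compactness yields the minimum. Finally `simpₙ(E) = simpₙ(K)` because volume is convex in each
vertex separately. -/

/-! ### Volumes of coordinate bodies and the Legendre polynomial. -/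

/-- The simplex `{c ≥ 0, ∑ cᵢ ≤ a}` in `ι → ℝ`. -/
def cornerSimplex (ι : Type*) [Fintype ι] (a : ℝ) : Set (ι → ℝ) :=
  {c | (∀ i, 0 ≤ c i) ∧ ∑ i, c i ≤ a}

theorem measurableSet_cornerSimplex (ι : Type*) [Fintype ι] (a : ℝ) :
    MeasurableSet (cornerSimplex ι a) := by
  refine IsClosed.measurableSet (IsClosed.and ?_ ?_)
  · simp only [Set.ofPred_forall]
    exact isClosed_iInter fun i => isClosed_le continuous_const (continuous_apply i)
  · exact isClosed_le (by fun_prop) continuous_const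

theorem lintegral_sub_pow (n : ℕ) {a : ℝ} (ha : 0 ≤ a) :
    ∫⁻ t in Set.Icc 0 a, ENNReal.ofReal ((a - t) ^ n / n.factorial)
      = ENNReal.ofReal (a ^ (n + 1) / (n + 1).factorial) := by
  rw [← ofReal_integral_eq_lintegral_ofReal]
  · rw [integral_Icc_eq_integral_Ioc, ← intervalIntegral.integral_of_le ha]
    simp only [intervalIntegral.integral_div,
      intervalIntegral.integral_comp_sub_left (fun t => t ^ n) a, integral_pow]
    congr 1
    rw [Nat.factorial_succ]
    push_cast
    field_simp
    simp
  · exact (by fun_prop : Continuous fun t : ℝ => (a - t) ^ n / n.factorial).integrableOn_Icc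
  · refine (ae_restrict_mem measurableSet_Icc).mono fun t ht => ?_
    have : 0 ≤ a - t := sub_nonneg.2 ht.2
    simp only [Pi.zero_apply]
    positivity

/-- Fubini in the first coordinate: the slice at `t ∈ [0, a]` is the corner simplex of size `a - t`,
and all other slices are empty. -/
theorem volume_cornerSimplex_fin (n : ℕ) {a : ℝ} (ha : 0 ≤ a) :
    volume (cornerSimplex (Fin n) a) = ENNReal.ofReal (a ^ n / n.factorial) := by
  induction n generalizing a with
  | zero =>
    have : cornerSimplex (Fin 0) a = Set.univ := by
      ext c; simp [cornerSimplex, ha]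
    rw [this]
    simp [volume_pi]
  | succ n ih =>
    have hp := volume_preserving_piFinSuccAbove (fun _ : Fin (n + 1) => ℝ) 0
    rw [← hp.symm.measure_preimage_equiv]
    have hm : MeasurableSet ((MeasurableEquiv.piFinSuccAbove (fun _ : Fin (n + 1) => ℝ) 0).symm ⁻¹'
        cornerSimplex (Fin (n + 1)) a) :=
      (MeasurableEquiv.measurable _) (measurableSet_cornerSimplex _ _)
    rw [Measure.volume_eq_prod, Measure.prod_apply hm, ← lintegral_sub_pow n ha,
      ← lintegral_indicator measurableSet_Icc]
    congr 1 with t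
    by_cases ht : t ∈ Set.Icc 0 a
    · rw [Set.indicator_of_mem ht, ← ih (sub_nonneg.2 ht.2)]
      congr 1 with c
      simp [cornerSimplex, Fin.forall_fin_succ, Fin.sum_univ_succ, ht.1, le_sub_iff_add_le']
    · rw [Set.indicator_of_notMem ht]
      convert! measure_empty (μ := volume)
      refine Set.eq_empty_of_forall_notMem fun c hc => ht ?_
      simp only [cornerSimplex, Set.mem_preimage, Set.mem_ofPred_eq, Fin.forall_fin_succ,
        Fin.sum_univ_succ, MeasurableEquiv.piFinSuccAbove_symm_apply, Fin.insertNthEquiv_apply,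
        Fin.insertNth_zero', Fin.cons_zero, Fin.cons_succ] at hc
      exact ⟨hc.1.1, by linarith [Finset.sum_nonneg fun i (_ : i ∈ Finset.univ) => hc.1.2 i]⟩

theorem volume_cornerSimplex (ι : Type*) [Fintype ι] {a : ℝ} (ha : 0 ≤ a) :
    volume (cornerSimplex ι a)
      = ENNReal.ofReal (a ^ Fintype.card ι / (Fintype.card ι).factorial) := by
  rw [← volume_cornerSimplex_fin _ ha, ← (volume_measurePreserving_piCongrLeft (fun _ : Fin _ => ℝ)
    (Fintype.equivFin ι)).measure_preimage_equiv]
  congr 1 with c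
  simp only [cornerSimplex, Set.mem_preimage, Set.mem_ofPred_eq,
    ← (Fintype.equivFin ι).sum_comp, (Fintype.equivFin ι).surjective.forall,
    MeasurableEquiv.coe_piCongrLeft, Equiv.piCongrLeft_apply_apply]

/-- The points whose negative parts add up to at most `α` and whose positive parts add up to at
most `β`. -/
def signedSimplex (ι : Type*) [Fintype ι] (α β : ℝ) : Set (ι → ℝ) :=
  {c | ∑ i, (c i)⁻ ≤ α ∧ ∑ i, (c i)⁺ ≤ β}

/-- Separating the coordinates in `s` from the others places this piece in the product of a
reflected corner simplex of size `α` and a corner simplex of size `β`. -/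
theorem volume_signedSimplex_orthant_le {ι : Type*} [Fintype ι] [DecidableEq ι] {α β : ℝ}
    (hα : 0 ≤ α) (hβ : 0 ≤ β) (s : Finset ι) :
    volume {c ∈ signedSimplex ι α β | ∀ i, i ∈ s ↔ c i < 0} ≤
      ENNReal.ofReal (α ^ s.card / s.card.factorial *
        (β ^ (Fintype.card ι - s.card) / (Fintype.card ι - s.card).factorial)) := by
  have hp : MeasurePreserving (MeasurableEquiv.piEquivPiSubtypeProd (fun _ : ι => ℝ) (· ∈ s)) := by
    convert! volume_preserving_piEquivPiSubtypeProd (fun _ : ι => ℝ) (· ∈ s)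
  have hn : volume (-cornerSimplex {i // i ∈ s} α)
      = ENNReal.ofReal (α ^ s.card / s.card.factorial) := by
    rw [Measure.measure_neg, volume_cornerSimplex _ hα, Fintype.card_coe]
  have hc : volume (cornerSimplex {i // i ∉ s} β) = ENNReal.ofReal
      (β ^ (Fintype.card ι - s.card) / (Fintype.card ι - s.card).factorial) := by
    rw [volume_cornerSimplex _ hβ, Fintype.card_subtype_compl, Fintype.card_coe]
  rw [ENNReal.ofReal_mul (by positivity), ← hn, ← hc, ← Measure.prod_prod, ← Measure.volume_eq_prod]
  refine (measure_mono ?_).trans (hp.measure_preimage_equiv _).le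
  refine fun c ⟨⟨h1, h2⟩, h3⟩ => ⟨⟨fun i => ?_, ?_⟩, fun i => ?_, ?_⟩
  · simpa using ((h3 i).1 i.2).le
  · refine le_trans ?_ h1
    calc _ = ∑ i : {i // i ∈ s}, (c i)⁻ := Finset.sum_congr rfl fun i _ => by
            rw [negPart_of_nonpos ((h3 i).1 i.2).le]; rfl
      _ = ∑ i ∈ s, (c i)⁻ := Finset.sum_coe_sort s fun i => (c i)⁻
      _ ≤ _ := Finset.sum_le_sum_of_subset_of_nonneg (Finset.subset_univ s)
            fun i _ _ => negPart_nonneg _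
  · have := (h3 i).not.1 i.2
    simpa using this
  · refine le_trans ?_ h2
    calc _ = ∑ i : {i // i ∉ s}, (c i)⁺ := Finset.sum_congr rfl fun i _ => by
            rw [posPart_of_nonneg (not_lt.1 ((h3 i).not.1 i.2))]; rfl
      _ = ∑ i ∈ Finset.univ.filter (· ∉ s), (c i)⁺ :=
            (Finset.sum_subtype _ (by simp) fun i => (c i)⁺).symm
      _ ≤ _ := Finset.sum_le_sum_of_subset_of_nonneg (Finset.subset_univ _)
            fun i _ _ => posPart_nonneg _

theorem volume_signedSimplex_le (n : ℕ) {t : ℝ} (ht : 1 ≤ t) :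
    volume (signedSimplex (Fin n) ((t - 1) / 2) ((t + 1) / 2)) ≤
      ENNReal.ofReal ((legendre n).eval t / n.factorial) := by
  set α := (t - 1) / 2 with hα
  set β := (t + 1) / 2 with hβ
  have hα0 : 0 ≤ α := by rw [hα]; linarith
  have hβ0 : 0 ≤ β := by rw [hβ]; linarith
  have hcover : signedSimplex (Fin n) α β ⊆ ⋃ s ∈ (Finset.univ : Finset (Fin n)).powerset,
      {c ∈ signedSimplex (Fin n) α β | ∀ i, i ∈ s ↔ c i < 0} := fun c hc => by
    simp only [Set.mem_iUnion]
    exact ⟨Finset.univ.filter (c · < 0), by simp, hc, by simp⟩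
  refine (measure_mono hcover).trans <| (measure_biUnion_finset_le _ _).trans <|
    (Finset.sum_le_sum fun s _ => volume_signedSimplex_orthant_le hα0 hβ0 s).trans ?_
  rw [← ENNReal.ofReal_sum_of_nonneg fun s _ => by positivity, Fintype.card_fin]
  refine ENNReal.ofReal_le_ofReal (le_of_eq ?_)
  -- The `n.choose k` sign patterns with `k` negative coordinates share one bound; its factor `1 /
  -- (k! (n-k)!)` supplies the second binomial coefficient of `legendre_eval`.
  rw [Finset.sum_powerset_apply_card
    (fun k => α ^ k / k.factorial * (β ^ (n - k) / (n - k).factorial)),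
    legendre_eval, Finset.mul_sum, Finset.sum_div, Finset.card_univ, Fintype.card_fin]
  refine Finset.sum_congr rfl fun k hk => ?_
  have hkn : k ≤ n := Nat.lt_succ_iff.1 (Finset.mem_range.1 hk)
  have hch : (n.choose k : ℝ) * k.factorial * (n - k).factorial = n.factorial := by
    exact_mod_cast Nat.choose_mul_factorial_mul_factorial hkn
  have h2 : (2 : ℝ) ^ n = 2 ^ k * 2 ^ (n - k) := by rw [← pow_add, Nat.add_sub_cancel' hkn]
  have hne : (n.choose k : ℝ) ≠ 0 := by exact_mod_cast (Nat.choose_pos hkn).ne'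
  rw [← hch, hα, hβ, h2, nsmul_eq_mul, div_pow, div_pow]
  field_simp

/-! ### Simplex volume as a function of the vertices. -/

/-- The matrix whose rows are the edges of the simplex `p` issuing from the vertex `p 0`. -/
def edgeMatrix {n : ℕ} (p : Fin (n + 1) → EuclideanSpace ℝ (Fin n)) : Matrix (Fin n) (Fin n) ℝ :=
  Matrix.of fun i k => p i.succ k - p 0 k

/-- The affine map taking `0` to `p 0` and the basis vectors to the other points of `p`. -/
def edgeParam {n : ℕ} (p : Fin (n + 1) → EuclideanSpace ℝ (Fin n)) (c : Fin n → ℝ) :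
    EuclideanSpace ℝ (Fin n) :=
  p 0 + ∑ i, c i • (p i.succ - p 0)

theorem edgeParam_eq_sum {n : ℕ} (p : Fin (n + 1) → EuclideanSpace ℝ (Fin n))
    {w : Fin (n + 1) → ℝ} (hw : ∑ j, w j = 1) :
    edgeParam p (fun i => w i.succ) = ∑ j, w j • p j := by
  rw [Fin.sum_univ_succ] at hw
  rw [edgeParam, Fin.sum_univ_succ, eq_sub_of_add_eq hw]
  simp only [smul_sub, Finset.sum_sub_distrib, ← Finset.sum_smul, sub_smul, one_smul]
  abel

theorem volume_edgeParam_image {n : ℕ} (p : Fin (n + 1) → EuclideanSpace ℝ (Fin n))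
    (A : Set (Fin n → ℝ)) :
    volume (edgeParam p '' A) = ENNReal.ofReal |(edgeMatrix p).det| * volume A := by
  have h : edgeParam p '' A = (fun x => p 0 + x) ''
      ((MeasurableEquiv.toLp 2 (Fin n → ℝ)) ''
        (Matrix.toLin' (edgeMatrix p).transpose '' A)) := by
    rw [Set.image_image, Set.image_image]
    refine Set.image_congr fun c _ => ?_
    rw [edgeParam]
    congr 1
    ext k
    simp [Matrix.mulVec, dotProduct, edgeMatrix, mul_comm]
  rw [h, Set.image_add_left, measure_preimage_add, MeasurableEquiv.image_eq_preimage_symm,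
    (PiLp.volume_preserving_ofLp (Fin n)).measure_preimage_equiv
      (f := (MeasurableEquiv.toLp 2 (Fin n → ℝ)).symm),
    Measure.addHaar_image_linearMap, LinearMap.det_toLin', Matrix.det_transpose]

theorem convexHull_range_eq_image_stdSimplex {ι V : Type*} [Fintype ι] [AddCommGroup V] [Module ℝ V]
    (p : ι → V) : convexHull ℝ (Set.range p) = (fun w : ι → ℝ => ∑ j, w j • p j) '' stdSimplex ℝ ι := by
  classical
  have h : (fun w : ι → ℝ => ∑ j, w j • p j) = Fintype.linearCombination ℝ p := by
    ext w
    rw [Fintype.linearCombination_apply]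
  rw [h, ← convexHull_rangle_single_eq_stdSimplex, LinearMap.image_convexHull, ← Set.range_comp]
  congr 2 with j
  simp

theorem convexHull_range_eq_edgeParam_image {n : ℕ}
    (p : Fin (n + 1) → EuclideanSpace ℝ (Fin n)) :
    convexHull ℝ (Set.range p) = edgeParam p '' cornerSimplex (Fin n) 1 := by
  ext x
  rw [convexHull_range_eq_image_stdSimplex]
  constructor
  · rintro ⟨w, ⟨h0, h1⟩, rfl⟩
    refine ⟨fun i => w i.succ, ⟨fun i => h0 _, ?_⟩, edgeParam_eq_sum p h1⟩
    rw [Fin.sum_univ_succ] at h1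
    linarith [h0 0]
  · rintro ⟨c, ⟨h0, h1⟩, rfl⟩
    have hw : ∑ j, (Fin.cons (1 - ∑ i, c i) c : Fin (n + 1) → ℝ) j = 1 := by
      simp [Fin.sum_univ_succ]
    refine ⟨Fin.cons (1 - ∑ i, c i) c, ⟨Fin.cases (by simpa using h1) (by simpa using h0), hw⟩, ?_⟩
    exact (edgeParam_eq_sum p hw).symm

/-- The volume of the (possibly degenerate) simplex spanned by `p`. -/
noncomputable def hullVol {n : ℕ} (p : Fin (n + 1) → EuclideanSpace ℝ (Fin n)) : ℝ :=
  volume.real (convexHull ℝ (Set.range p))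

theorem hullVol_eq {n : ℕ} (p : Fin (n + 1) → EuclideanSpace ℝ (Fin n)) :
    hullVol p = |(edgeMatrix p).det| / n.factorial := by
  rw [hullVol, Measure.real, convexHull_range_eq_edgeParam_image, volume_edgeParam_image,
    volume_cornerSimplex_fin n zero_le_one, ENNReal.toReal_mul,
    ENNReal.toReal_ofReal (abs_nonneg _), ENNReal.toReal_ofReal (by positivity), one_pow,
    mul_one_div]

theorem hullVol_nonneg {n : ℕ} (p : Fin (n + 1) → EuclideanSpace ℝ (Fin n)) : 0 ≤ hullVol p :=
  measureReal_nonneg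

theorem continuous_hullVol (n : ℕ) :
    Continuous (hullVol : (Fin (n + 1) → EuclideanSpace ℝ (Fin n)) → ℝ) := by
  simp only [funext hullVol_eq]
  refine (Continuous.abs (Continuous.matrix_det (continuous_matrix fun i k => ?_))).div_const _
  simp only [edgeMatrix, Matrix.of_apply]
  fun_prop

theorem hullVol_comp_perm {n : ℕ} (p : Fin (n + 1) → EuclideanSpace ℝ (Fin n))
    (σ : Equiv.Perm (Fin (n + 1))) : hullVol (p ∘ σ) = hullVol p := by
  rw [hullVol, σ.surjective.range_comp, hullVol]

theorem hullVol_pos_iff {n : ℕ} (p : Fin (n + 1) → EuclideanSpace ℝ (Fin n)) :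
    0 < hullVol p ↔ AffineIndependent ℝ p := by
  rw [hullVol_eq, affineIndependent_iff_linearIndependent_vsub ℝ p 0,
    ← linearIndependent_equiv (finSuccAboveEquiv (0 : Fin (n + 1))),
    ← (WithLp.linearEquiv 2 ℝ (Fin n → ℝ)).toLinearMap.linearIndependent_iff (by simp)]
  have : ((WithLp.linearEquiv 2 ℝ (Fin n → ℝ)).toLinearMap ∘
      (fun i : {x // x ≠ (0 : Fin (n + 1))} => (p i -ᵥ p 0 : EuclideanSpace ℝ (Fin n))) ∘
      finSuccAboveEquiv (0 : Fin (n + 1))) = (edgeMatrix p).row := by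
    ext i k
    simp only [Function.comp_apply, finSuccAboveEquiv_apply, Fin.zero_succAbove]
    simp [edgeMatrix]
  rw [this, Matrix.linearIndependent_rows_iff_isUnit, Matrix.isUnit_iff_isUnit_det,
    isUnit_iff_ne_zero, div_pos_iff_of_pos_right (by positivity), abs_pos]

/-- The new edge is a combination of the old edges, and the determinant retains only the coefficient
of the edge replaced. -/
theorem hullVol_update_sum_succ {n : ℕ} (p : Fin (n + 1) → EuclideanSpace ℝ (Fin n))
    {w : Fin (n + 1) → ℝ} (hw : ∑ j, w j = 1) (i : Fin n) :
    hullVol (Function.update p i.succ (∑ j, w j • p j)) = |w i.succ| * hullVol p := by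
  have h : edgeMatrix (Function.update p i.succ (∑ j, w j • p j)) =
      (edgeMatrix p).updateRow i (∑ k, w k.succ • edgeMatrix p k) := by
    rw [← edgeParam_eq_sum p hw]
    ext a k
    rcases eq_or_ne a i with rfl | ha
    · simp [edgeMatrix, edgeParam, (Fin.succ_ne_zero _).symm]
    · simp [edgeMatrix, ha, (Fin.succ_ne_zero _).symm]
  rw [hullVol_eq, h, Matrix.det_updateRow_sum, hullVol_eq, smul_eq_mul, abs_mul, mul_div_assoc]

/-- Cramer's rule for barycentric coordinates, up to sign. -/
theorem hullVol_update_sum {n : ℕ} (hn : 1 ≤ n) (p : Fin (n + 1) → EuclideanSpace ℝ (Fin n))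
    {w : Fin (n + 1) → ℝ} (hw : ∑ j, w j = 1) (j : Fin (n + 1)) :
    hullVol (Function.update p j (∑ j, w j • p j)) = |w j| * hullVol p := by
  obtain ⟨m, rfl⟩ : ∃ m, n = m + 1 := ⟨n - 1, by omega⟩
  -- Vertex `0` is the base point of `edgeMatrix`, so `j` is relabelled as a nonzero index; one
  -- exists because `n ≥ 1`.
  set σ : Equiv.Perm (Fin (m + 1 + 1)) := Equiv.swap j (Fin.succ 0)
  have h := hullVol_update_sum_succ (p ∘ σ) (w := w ∘ σ) (by rw [← hw]; exact Equiv.sum_comp σ w) 0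
  have e : ∑ k, (w ∘ σ) k • (p ∘ σ) k = ∑ k, w k • p k := Equiv.sum_comp σ fun k => w k • p k
  have e2 : Function.update (p ∘ σ) (Fin.succ 0) (∑ k, w k • p k)
      = Function.update p j (∑ k, w k • p k) ∘ σ := by
    rw [Function.update_comp_equiv]
    congr 1
    simp [σ]
  rw [e, e2, hullVol_comp_perm, hullVol_comp_perm] at h
  simpa [σ] using h

/-- The determinant is affine in a single vertex, and the absolute value of an affine function is
convex. -/
theorem convexOn_hullVol_update_succ {n : ℕ} (p : Fin (n + 1) → EuclideanSpace ℝ (Fin n))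
    (i : Fin n) : ConvexOn ℝ Set.univ fun x => hullVol (Function.update p i.succ x) := by
  refine ⟨convex_univ, fun x _ y _ a b ha hb hab => ?_⟩
  have hrow (z : EuclideanSpace ℝ (Fin n)) : edgeMatrix (Function.update p i.succ z) =
      (edgeMatrix p).updateRow i (fun k => z k - p 0 k) := by
    ext c k
    rcases eq_or_ne c i with rfl | ha
    · simp [edgeMatrix, (Fin.succ_ne_zero _).symm]
    · simp [edgeMatrix, ha, (Fin.succ_ne_zero _).symm]
  have hlin : (fun k => (a • x + b • y) k - p 0 k)
      = a • (fun k => x k - p 0 k) + b • fun k => y k - p 0 k := by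
    ext k
    simp only [PiLp.add_apply, PiLp.smul_apply, Pi.add_apply, Pi.smul_apply, smul_eq_mul]
    linear_combination p 0 k * hab
  simp only [hullVol_eq, hrow, hlin, Matrix.det_updateRow_add, Matrix.det_updateRow_smul,
    smul_eq_mul]
  rw [← mul_div_assoc, ← mul_div_assoc, ← add_div]
  gcongr
  refine (abs_add_le _ _).trans_eq ?_
  rw [abs_mul, abs_mul, abs_of_nonneg ha, abs_of_nonneg hb]

theorem convexOn_hullVol_update {n : ℕ} (hn : 1 ≤ n)
    (p : Fin (n + 1) → EuclideanSpace ℝ (Fin n)) (j : Fin (n + 1)) :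
    ConvexOn ℝ Set.univ fun x => hullVol (Function.update p j x) := by
  obtain ⟨m, rfl⟩ : ∃ m, n = m + 1 := ⟨n - 1, by omega⟩
  set σ : Equiv.Perm (Fin (m + 1 + 1)) := Equiv.swap j (Fin.succ 0)
  convert! convexOn_hullVol_update_succ (p ∘ σ) 0 using 2 with x
  rw [← hullVol_comp_perm _ σ, Function.update_comp_equiv]
  simp [σ]

/-- A bound for the volumes of simplices with vertices in `E` holds for those with vertices in the
convex hull of `E`. -/
theorem hullVol_le_of_forall_mem_convexHull {n : ℕ} (hn : 1 ≤ n)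
    {E : Set (EuclideanSpace ℝ (Fin n))} {m : ℝ} (hm : ∀ p, (∀ j, p j ∈ E) → hullVol p ≤ m)
    {p : Fin (n + 1) → EuclideanSpace ℝ (Fin n)} (hp : ∀ j, p j ∈ convexHull ℝ E) :
    hullVol p ≤ m := by
  -- Vertices are moved into `E` one at a time without decreasing the volume; `s` collects those not
  -- yet moved.
  suffices H : ∀ (s : Finset (Fin (n + 1))) (p : Fin (n + 1) → EuclideanSpace ℝ (Fin n)),
      (∀ j ∈ s, p j ∈ convexHull ℝ E) → (∀ j ∉ s, p j ∈ E) → hullVol p ≤ m from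
    H Finset.univ p (fun j _ => hp j) (by simp)
  intro s
  induction s using Finset.induction_on with
  | empty => exact fun p _ h => hm p fun j => h j (by simp)
  | insert a s ha ih =>
    intro p h1 h2
    obtain ⟨y, hy, hle⟩ := (convexOn_hullVol_update hn p a).exists_ge_of_mem_convexHull
      (Set.subset_univ E) (h1 a (by simp))
    rw [Function.update_eq_self] at hle
    refine hle.trans (ih _ (fun j hj => ?_) fun j hj => ?_)
    · rw [Function.update_of_ne (by rintro rfl; exact ha hj)]
      exact h1 j (by simp [hj])
    · rcases eq_or_ne j a with rfl | hja
      · simpa using hy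
      · rw [Function.update_of_ne hja]
        exact h2 j (by simp [hj, hja])

/-! ### The Legendre bound for the convex hull. -/

/-- If all points of `E` have barycentric coordinates with respect to `p` of `ℓ¹` norm at most
`t`, then the volume of the convex hull of `E` is at most `χₙ(t)` times that of the simplex. -/
theorem volume_convexHull_le {n : ℕ} {E : Set (EuclideanSpace ℝ (Fin n))}
    {p : Fin (n + 1) → EuclideanSpace ℝ (Fin n)} {t : ℝ} (ht : 1 ≤ t)
    (h : ∀ x ∈ E, ∃ w : Fin (n + 1) → ℝ,
      ∑ j, w j = 1 ∧ ∑ j, |w j| ≤ t ∧ ∑ j, w j • p j = x) :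
    volume.real (convexHull ℝ E) ≤ hullVol p * (legendre n).eval t := by
  have hsub : convexHull ℝ E ⊆
      edgeParam p '' signedSimplex (Fin n) ((t - 1) / 2) ((t + 1) / 2) := by
    have hconv : Convex ℝ {x | ∃ w : Fin (n + 1) → ℝ,
        ∑ j, w j = 1 ∧ ∑ j, |w j| ≤ t ∧ ∑ j, w j • p j = x} := by
      rintro _ ⟨w, h1, h2, rfl⟩ _ ⟨v, h3, h4, rfl⟩ a b ha hb hab
      refine ⟨a • w + b • v, ?_, ?_, ?_⟩
      · simp [Finset.sum_add_distrib, ← Finset.mul_sum, h1, h3, hab]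
      · calc ∑ j, |(a • w + b • v) j| ≤ ∑ j, (a * |w j| + b * |v j|) :=
              Finset.sum_le_sum fun j _ => (abs_add_le _ _).trans_eq (by
                simp [abs_mul, abs_of_nonneg ha, abs_of_nonneg hb])
          _ = a * ∑ j, |w j| + b * ∑ j, |v j| := by
              rw [Finset.sum_add_distrib, Finset.mul_sum, Finset.mul_sum]
          _ ≤ a * t + b * t := by gcongr
          _ = t := by rw [← add_mul, hab, one_mul]
      · simp [add_smul, mul_smul, Finset.sum_add_distrib, Finset.smul_sum]
    refine (convexHull_min h hconv).trans ?_
    rintro _ ⟨w, h1, h2, rfl⟩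
    refine ⟨fun i => w i.succ, ?_, edgeParam_eq_sum p h1⟩
    have hneg : ∑ j, (w j)⁻ = (∑ j, |w j| - ∑ j, w j) / 2 := by
      rw [← Finset.sum_sub_distrib, Finset.sum_div]
      exact Finset.sum_congr rfl fun j _ => by
        linarith [posPart_add_negPart (w j), posPart_sub_negPart (w j)]
    have hpos : ∑ j, (w j)⁺ = (∑ j, |w j| + ∑ j, w j) / 2 := by
      rw [← Finset.sum_add_distrib, Finset.sum_div]
      exact Finset.sum_congr rfl fun j _ => by
        linarith [posPart_add_negPart (w j), posPart_sub_negPart (w j)]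
    rw [h1] at hneg hpos
    rw [Fin.sum_univ_succ] at hneg hpos
    -- Omitting the coordinate of `p 0` can only decrease both sums.
    exact ⟨by linarith [negPart_nonneg (w 0)], by linarith [posPart_nonneg (w 0)]⟩
  have hle := measure_mono (μ := volume) hsub
  rw [volume_edgeParam_image] at hle
  have hle := hle.trans (mul_le_mul_right (volume_signedSimplex_le n ht) _)
  rw [← ENNReal.ofReal_mul (abs_nonneg _)] at hle
  have hχ : 0 ≤ (legendre n).eval t := by
    rw [legendre_eval]
    have a : 0 ≤ t - 1 := by linarith
    have b : 0 ≤ t + 1 := by linarith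
    positivity
  rw [hullVol_eq]
  calc _ ≤ |(edgeMatrix p).det| * ((legendre n).eval t / n.factorial) :=
        ENNReal.toReal_le_of_le_ofReal (by positivity) hle
    _ = _ := by ring

/-! ### Interpolation projectors and their norms. -/

section

/-- By linearity it suffices to treat monomials of degree `0`, where `∑ w j = 1` enters, and of
degree `1`. -/
theorem eval_sum_smul_of_mem_restrictTotalDegree_one {σ ι : Type*} [Fintype ι]
    {q : MvPolynomial σ ℝ} (hq : q ∈ MvPolynomial.restrictTotalDegree σ ℝ 1) {w : ι → ℝ}
    (hw : ∑ j, w j = 1) (x : ι → σ → ℝ) :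
    MvPolynomial.eval (fun i => ∑ j, w j * x j i) q = ∑ j, w j * MvPolynomial.eval (x j) q := by
  rw [MvPolynomial.restrictTotalDegree, MvPolynomial.restrictSupport_eq_span] at hq
  induction hq using Submodule.span_induction with
  | mem q h =>
    obtain ⟨m, hm, rfl⟩ := h
    have hm : m.degree ≤ 1 := hm
    rcases Nat.le_one_iff_eq_zero_or_eq_one.1 hm with h0 | h1
    · rw [Finsupp.degree_eq_zero_iff] at h0
      simp [h0, hw]
    · obtain ⟨i, rfl⟩ := (Finsupp.sum_eq_one_iff m).1 h1
      simp [MvPolynomial.eval_monomial]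
  | zero => simp
  | add a b _ _ ha hb => simp [ha, hb, mul_add, Finset.sum_add_distrib]
  | smul r a _ ha =>
    simp only [MvPolynomial.smul_eval, ha, Finset.mul_sum]
    exact Finset.sum_congr rfl fun j _ => by ring

theorem exists_mem_restrictTotalDegree_one_eval_eq {n : ℕ}
    (f : EuclideanSpace ℝ (Fin n) →ᵃ[ℝ] ℝ) :
    ∃ q ∈ MvPolynomial.restrictTotalDegree (Fin n) ℝ 1,
      ∀ x : EuclideanSpace ℝ (Fin n), MvPolynomial.eval (fun i => x i) q = f x := by
  refine ⟨MvPolynomial.C (f 0) + ∑ i, MvPolynomial.C (f.linear (EuclideanSpace.single i 1)) *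
    MvPolynomial.X i, Submodule.add_mem _ ?_ (Submodule.sum_mem _ fun i _ => ?_), fun x => ?_⟩
  · rw [MvPolynomial.mem_restrictTotalDegree]
    simp
  · rw [MvPolynomial.mem_restrictTotalDegree]
    refine (MvPolynomial.totalDegree_mul _ _).trans ?_
    simp
  · have hx : x = ∑ i, x i • EuclideanSpace.single i (1 : ℝ) := by
      ext k
      simp [Pi.single_apply]
    have hf : f x = f.linear x + f 0 := by
      simpa using f.map_vadd 0 x
    rw [hf]
    conv_rhs => rw [hx]
    simp [map_sum, add_comm, mul_comm]

/-- The affine basis formed by the vertices of a nondegenerate simplex. -/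
noncomputable def simplexBasis {n : ℕ} (S : Affine.Simplex ℝ (EuclideanSpace ℝ (Fin n)) n) :
    AffineBasis (Fin (n + 1)) ℝ (EuclideanSpace ℝ (Fin n)) :=
  ⟨S.points, S.independent,
    S.independent.affineSpan_eq_top_iff_card_eq_finrank_add_one.2 (by simp)⟩

theorem simplexBasis_apply {n : ℕ} (S : Affine.Simplex ℝ (EuclideanSpace ℝ (Fin n)) n)
    (j : Fin (n + 1)) : simplexBasis S j = S.points j := rfl

theorem sum_coord_smul_points {n : ℕ} (S : Affine.Simplex ℝ (EuclideanSpace ℝ (Fin n)) n)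
    (x : EuclideanSpace ℝ (Fin n)) :
    ∑ j, (simplexBasis S).coord j x • S.points j = x :=
  (simplexBasis S).linear_combination_coord_eq_self x

variable {n : ℕ} {E : TopologicalSpace.Compacts (EuclideanSpace ℝ (Fin n))}
  {S : Affine.Simplex ℝ (EuclideanSpace ℝ (Fin n)) n}

theorem exists_isInterpolationProjector (hS : ∀ j, S.points j ∈ E) :
    ∃ P, IsInterpolationProjector E S P := by
  have hc (j) : Continuous fun y : E => (simplexBasis S).coord j y :=
    ((simplexBasis S).coord j).continuous_of_finiteDimensional.comp continuous_subtype_val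
  refine ⟨∑ j, (ContinuousMap.evalCLM ℝ (⟨S.points j, hS j⟩ : E)).smulRight
    (⟨fun y => (simplexBasis S).coord j y, hc j⟩ : C(E, ℝ)), hS, fun f => ?_⟩
  choose q hq hqe using fun j => exists_mem_restrictTotalDegree_one_eval_eq
    ((simplexBasis S).coord j)
  refine ⟨∑ j, f ⟨S.points j, hS j⟩ • q j,
    Submodule.sum_mem _ fun j _ => Submodule.smul_mem _ _ (hq j), fun y => ?_, fun y j hy => ?_⟩
  · simp [map_sum, MvPolynomial.smul_eval, hqe, ContinuousMap.sum_apply]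
  · obtain ⟨y, hyE⟩ := y
    obtain rfl : y = S.points j := hy
    simp [map_sum, MvPolynomial.smul_eval, hqe, ← simplexBasis_apply, AffineBasis.coord_apply]

namespace IsInterpolationProjector

variable {P : C(E, ℝ) →L[ℝ] C(E, ℝ)}

/-- Polynomials of degree at most `1` preserve affine combinations, so the nodal values determine `P
f`. -/
theorem apply_eq (h : IsInterpolationProjector E S P) (f : C(E, ℝ)) (y : E) :
    P f y = ∑ j, (simplexBasis S).coord j y * f ⟨S.points j, h.1 j⟩ := by
  obtain ⟨q, hq, h1, h2⟩ := h.2 f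
  rw [h1]
  have hy : (fun i => (y : EuclideanSpace ℝ (Fin n)) i)
      = fun i => ∑ j, (simplexBasis S).coord j y * S.points j i := by
    ext i
    conv_lhs => rw [← sum_coord_smul_points S y]
    simp
  rw [hy, eval_sum_smul_of_mem_restrictTotalDegree_one hq
    ((simplexBasis S).sum_coord_apply_eq_one _) fun j i => S.points j i]
  exact Finset.sum_congr rfl fun j _ => by rw [← h2 ⟨S.points j, h.1 j⟩ j rfl]

theorem sum_abs_coord_le_norm (h : IsInterpolationProjector E S P)
    {x : EuclideanSpace ℝ (Fin n)} (hx : x ∈ E) :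
    ∑ j, |(simplexBasis S).coord j x| ≤ ‖P‖ := by
  have he : Topology.IsClosedEmbedding fun j => (⟨S.points j, h.1 j⟩ : E) :=
    (continuous_of_discreteTopology).isClosedEmbedding fun i j hij =>
      S.independent.injective (congrArg Subtype.val hij)
  -- Tietze extends the signs of the coordinates of `x` from the vertices to `E` without increasing
  -- the norm; `P g` then takes the value `∑ |λⱼ(x)|` at `x`.
  obtain ⟨g, hg, hge⟩ := BoundedContinuousFunction.exists_extension_norm_eq_of_isClosedEmbedding
    (BoundedContinuousFunction.mkOfCompact
      ⟨fun j => SignType.sign ((simplexBasis S).coord j x), continuous_of_discreteTopology⟩) he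
  have hg1 : ‖g‖ ≤ 1 := by
    rw [hg, BoundedContinuousFunction.norm_le zero_le_one]
    intro j
    rcases lt_trichotomy ((simplexBasis S).coord j x) 0 with hj | hj | hj <;> simp [hj]
  have hval (j) : g ⟨S.points j, h.1 j⟩ = SignType.sign ((simplexBasis S).coord j x) :=
    congrFun hge j
  calc ∑ j, |(simplexBasis S).coord j x| = P g.toContinuousMap ⟨x, hx⟩ := by
        rw [h.apply_eq]
        exact Finset.sum_congr rfl fun j _ => (by
          rw [BoundedContinuousFunction.coe_toContinuousMap, hval, self_mul_sign])
    _ ≤ ‖P g.toContinuousMap‖ := (Real.le_norm_self _).trans (ContinuousMap.norm_coe_le_norm _ _)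
    _ ≤ ‖P‖ * ‖g.toContinuousMap‖ := P.le_opNorm _
    _ ≤ ‖P‖ * 1 := by
        gcongr
        exact (ContinuousMap.norm_le _ zero_le_one).2 fun y => (g.norm_coe_le_norm y).trans hg1
    _ = ‖P‖ := mul_one _

theorem norm_le (h : IsInterpolationProjector E S P) {r : ℝ} (hr : 0 ≤ r)
    (hx : ∀ x ∈ E, ∑ j, |(simplexBasis S).coord j x| ≤ r) : ‖P‖ ≤ r := by
  refine P.opNorm_le_bound hr fun f => (ContinuousMap.norm_le _ (by positivity)).2 fun y => ?_
  rw [h.apply_eq]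
  calc ‖∑ j, (simplexBasis S).coord j y * f ⟨S.points j, h.1 j⟩‖
      ≤ ∑ j, |(simplexBasis S).coord j y| * ‖f‖ := norm_sum_le_of_le _ fun j _ => by
        rw [norm_mul, Real.norm_eq_abs]
        gcongr
        exact f.norm_coe_le_norm _
    _ ≤ r * ‖f‖ := by
        rw [← Finset.sum_mul]
        gcongr
        exact hx y y.2

theorem one_le_norm (h : IsInterpolationProjector E S P) : 1 ≤ ‖P‖ := by
  refine le_trans ?_ (h.sum_abs_coord_le_norm (h.1 0))
  rw [← (simplexBasis S).sum_coord_apply_eq_one (S.points 0)]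
  exact Finset.sum_le_sum fun j _ => le_abs_self _

theorem volume_convexHull_le (h : IsInterpolationProjector E S P) :
    volume.real (convexHull ℝ (E : Set (EuclideanSpace ℝ (Fin n))))
      ≤ hullVol S.points * (legendre n).eval ‖P‖ :=
  _root_.volume_convexHull_le h.one_le_norm fun x hx => ⟨fun j => (simplexBasis S).coord j x,
    (simplexBasis S).sum_coord_apply_eq_one x, h.sum_abs_coord_le_norm hx,
    sum_coord_smul_points S x⟩

end IsInterpolationProjector

/-! ### Existence of the extremal simplices. -/

/-- The largest sum of the volumes of the simplices obtained from `p` by replacing one vertex by a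
point of `E`. -/
noncomputable def maxReplacedVol (E : Set (EuclideanSpace ℝ (Fin n)))
    (p : Fin (n + 1) → EuclideanSpace ℝ (Fin n)) : ℝ :=
  sSup ((fun x => ∑ j, hullVol (Function.update p j x)) '' E)

theorem continuous_replacedVol (n : ℕ) :
    Continuous fun a : (Fin (n + 1) → EuclideanSpace ℝ (Fin n)) × EuclideanSpace ℝ (Fin n) =>
      ∑ j, hullVol (Function.update a.1 j a.2) :=
  continuous_finsetSum _ fun j _ =>
    (continuous_hullVol n).comp (continuous_fst.update j continuous_snd)

theorem continuous_maxReplacedVol (E : TopologicalSpace.Compacts (EuclideanSpace ℝ (Fin n))) :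
    Continuous (maxReplacedVol (E : Set (EuclideanSpace ℝ (Fin n)))) :=
  E.isCompact.continuous_sSup (continuous_replacedVol n)

/-- By Cramer's rule `|λⱼ(x)|` is a ratio of simplex volumes. This makes the norm a function of the
vertices alone, continuous wherever the volume is nonzero. -/
theorem IsInterpolationProjector.norm_eq (hn : 1 ≤ n) {P : C(E, ℝ) →L[ℝ] C(E, ℝ)}
    (h : IsInterpolationProjector E S P) :
    ‖P‖ = maxReplacedVol E S.points / hullVol S.points := by
  have hpos : 0 < hullVol S.points := (hullVol_pos_iff _).2 S.independent
  have key (x : EuclideanSpace ℝ (Fin n)) : ∑ j, hullVol (Function.update S.points j x)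
      = (∑ j, |(simplexBasis S).coord j x|) * hullVol S.points := by
    rw [Finset.sum_mul]
    refine Finset.sum_congr rfl fun j _ => ?_
    rw [← hullVol_update_sum hn S.points ((simplexBasis S).sum_coord_apply_eq_one x) j,
      sum_coord_smul_points]
  have hbdd : BddAbove ((fun x => ∑ j, hullVol (Function.update S.points j x)) ''
      (E : Set (EuclideanSpace ℝ (Fin n)))) :=
    (E.isCompact.image ((continuous_replacedVol n).comp (Continuous.prodMk_right _))).bddAbove
  apply le_antisymm
  · refine h.norm_le (div_nonneg (Real.sSup_nonneg ?_) hpos.le) fun x hx => ?_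
    · rintro _ ⟨x, -, rfl⟩
      exact Finset.sum_nonneg fun j _ => hullVol_nonneg _
    · rw [le_div_iff₀ hpos, ← key]
      exact le_csSup hbdd ⟨x, hx, rfl⟩
  · rw [div_le_iff₀ hpos]
    refine csSup_le ⟨_, S.points 0, h.1 0, rfl⟩ ?_
    rintro _ ⟨x, hx, rfl⟩
    simp only [key]
    gcongr
    exact h.sum_abs_coord_le_norm hx

/-- If `E` lay in a proper affine subspace, so would its hull, which would then be null; hence `E`
contains an affine basis. -/
theorem exists_simplex_of_volume_pos {E : Set (EuclideanSpace ℝ (Fin n))}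
    (hE : 0 < volume (convexHull ℝ E)) :
    ∃ S : Affine.Simplex ℝ (EuclideanSpace ℝ (Fin n)) n, ∀ j, S.points j ∈ E := by
  have hspan : affineSpan ℝ E = ⊤ := by
    by_contra hne
    refine hE.ne' (measure_mono_null (convexHull_subset_affineSpan E) ?_)
    exact Measure.addHaar_affineSubspace _ _ hne
  obtain ⟨s, hs, b, hb⟩ := AffineBasis.exists_affine_subbasis hspan
  have hfin : Finite s := finite_of_fin_dim_affineIndependent ℝ b.ind
  have := Fintype.ofFinite s
  have hcard : Fintype.card s = n + 1 := by
    simpa using b.card_eq_finrank_add_one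
  let e : Fin (n + 1) ≃ s := (Fintype.equivFinOfCardEq hcard).symm
  exact ⟨⟨b ∘ e, b.ind.comp_embedding e.toEmbedding⟩, fun j => by simpa [hb] using hs (e j).2⟩

theorem exists_isLeast_projectorNorms (hn : 1 ≤ n)
    (hK : 0 < volume (convexHull ℝ (E : Set (EuclideanSpace ℝ (Fin n))))) :
    ∃ r, IsLeast (projectorNorms E) r := by
  set v := volume.real (convexHull ℝ (E : Set (EuclideanSpace ℝ (Fin n)))) with hv
  have hv0 : 0 < v := ENNReal.toReal_pos hK.ne'
    (isBounded_convexHull.2 E.isCompact.isBounded).measure_lt_top.ne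
  obtain ⟨S₀, hS₀⟩ := exists_simplex_of_volume_pos hK
  obtain ⟨P₀, hP₀⟩ := exists_isInterpolationProjector hS₀
  have hχ {t : ℝ} (ht : 1 ≤ t) : 0 < (legendre n).eval t :=
    zero_lt_one.trans_le ((legendre_bijOn n hn).mapsTo ht)
  -- A simplex whose projector has norm at most `‖P₀‖` has volume at least `v / χₙ(‖P₀‖)`, so `C` is
  -- a compact set of nondegenerate tuples containing every competitor.
  set C : Set (Fin (n + 1) → EuclideanSpace ℝ (Fin n)) :=
    Set.univ.pi (fun _ => (E : Set (EuclideanSpace ℝ (Fin n)))) ∩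
      {p | v / (legendre n).eval ‖P₀‖ ≤ hullVol p}
  have hC : IsCompact C := (isCompact_univ_pi fun _ => E.isCompact).inter_right
    (isClosed_le continuous_const (continuous_hullVol n))
  have hCpos {p} (hp : p ∈ C) : 0 < hullVol p :=
    (div_pos hv0 (hχ hP₀.one_le_norm)).trans_le hp.2
  have hmem {S P} (h : IsInterpolationProjector E S P) (hle : ‖P‖ ≤ ‖P₀‖) : S.points ∈ C := by
    refine ⟨fun j _ => h.1 j, ?_⟩
    rw [Set.mem_ofPred_eq, div_le_iff₀ (hχ hP₀.one_le_norm)]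
    refine h.volume_convexHull_le.trans ?_
    gcongr
    · exact hullVol_nonneg _
    · exact (legendre_strictMonoOn n hn).monotoneOn h.one_le_norm hP₀.one_le_norm hle
  obtain ⟨p, hp, hmin⟩ := hC.exists_isMinOn ⟨_, hmem hP₀ le_rfl⟩
    (f := fun p => maxReplacedVol E p / hullVol p)
    ((continuous_maxReplacedVol E).continuousOn.div (continuous_hullVol n).continuousOn
      fun p hp => (hCpos hp).ne')
  obtain ⟨P, hP⟩ := exists_isInterpolationProjector
    (S := ⟨p, (hullVol_pos_iff p).1 (hCpos hp)⟩) (E := E) fun j => hp.1 j trivial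
  refine ⟨‖P‖, ⟨_, P, hP, rfl⟩, ?_⟩
  have hle {S Q} (h : IsInterpolationProjector E S Q) (hQ : ‖Q‖ ≤ ‖P₀‖) : ‖P‖ ≤ ‖Q‖ := by
    rw [hP.norm_eq hn, h.norm_eq hn]
    exact hmin (hmem h hQ)
  rintro _ ⟨S, Q, hQ, rfl⟩
  rcases le_total ‖Q‖ ‖P₀‖ with h | h
  · exact hle hQ h
  · exact (hle hP₀ le_rfl).trans h

theorem exists_isGreatest_simplexVolumes
    (hK : 0 < volume (convexHull ℝ (E : Set (EuclideanSpace ℝ (Fin n))))) :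
    ∃ v > 0, IsGreatest (simplexVolumes (E : Set (EuclideanSpace ℝ (Fin n)))) v ∧
      ∀ p, (∀ j, p j ∈ (E : Set (EuclideanSpace ℝ (Fin n)))) → hullVol p ≤ v := by
  obtain ⟨S₀, hS₀⟩ := exists_simplex_of_volume_pos hK
  -- Degenerate tuples are admitted for compactness; the maximiser is nondegenerate since its volume
  -- is at least that of `S₀`.
  obtain ⟨p, hp, hmax⟩ := (isCompact_univ_pi fun _ : Fin (n + 1) => E.isCompact).exists_isMaxOn
    ⟨S₀.points, fun j _ => hS₀ j⟩ (continuous_hullVol n).continuousOn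
  have hle (q) (hq : ∀ j, q j ∈ (E : Set (EuclideanSpace ℝ (Fin n)))) : hullVol q ≤ hullVol p :=
    hmax fun j _ => hq j
  have hpos : 0 < hullVol p := ((hullVol_pos_iff _).2 S₀.independent).trans_le (hle _ hS₀)
  refine ⟨hullVol p, hpos, ⟨⟨⟨p, (hullVol_pos_iff p).1 hpos⟩, fun j => hp j trivial, rfl⟩, ?_⟩, hle⟩
  rintro _ ⟨S, hS, rfl⟩
  exact hle _ hS

end

/-! ### The main theorem. -/

theorem mainTheorem8 (n : ℕ) (hn : 1 ≤ n)
    (E : TopologicalSpace.Compacts (EuclideanSpace ℝ (Fin n)))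
    (hK : 0 < volume (convexHull ℝ (E : Set (EuclideanSpace ℝ (Fin n))))) :
    -- `θₙ(E)` is a minimum; `simpₙ(E)` and `simpₙ(K)` are maxima
    IsLeast (projectorNorms E) (theta E) ∧
    IsGreatest (simplexVolumes (E : Set (EuclideanSpace ℝ (Fin n))))
      (simpVol (E : Set (EuclideanSpace ℝ (Fin n)))) ∧
    IsGreatest (simplexVolumes (convexHull ℝ (E : Set (EuclideanSpace ℝ (Fin n)))))
      (simpVol (convexHull ℝ (E : Set (EuclideanSpace ℝ (Fin n))))) ∧
    -- `simpₙ(E) = simpₙ(K) > 0`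
    0 < simpVol (E : Set (EuclideanSpace ℝ (Fin n))) ∧
    simpVol (E : Set (EuclideanSpace ℝ (Fin n)))
      = simpVol (convexHull ℝ (E : Set (EuclideanSpace ℝ (Fin n)))) ∧
    -- the argument of `χₙ⁻¹` lies in `[1, ∞)`, and the inequality holds
    1 ≤ volume.real (convexHull ℝ (E : Set (EuclideanSpace ℝ (Fin n))))
      / simpVol (E : Set (EuclideanSpace ℝ (Fin n))) ∧
    theta E ≥ legendreInv n (volume.real (convexHull ℝ (E : Set (EuclideanSpace ℝ (Fin n))))
      / simpVol (E : Set (EuclideanSpace ℝ (Fin n)))) := by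
  obtain ⟨r, hr⟩ := exists_isLeast_projectorNorms hn hK
  obtain ⟨v, hv0, hv, hle⟩ := exists_isGreatest_simplexVolumes hK
  have hvK : IsGreatest (simplexVolumes (convexHull ℝ (E : Set (EuclideanSpace ℝ (Fin n))))) v := by
    refine ⟨?_, ?_⟩
    · obtain ⟨S, hS, hSv⟩ := hv.1
      exact ⟨S, fun j => subset_convexHull ℝ _ (hS j), hSv⟩
    · rintro _ ⟨S, hS, rfl⟩
      exact hullVol_le_of_forall_mem_convexHull hn hle hS
  have hθ : theta E = r := hr.csInf_eq
  have hE : simpVol (E : Set (EuclideanSpace ℝ (Fin n))) = v := hv.csSup_eq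
  have hEK : simpVol (convexHull ℝ (E : Set (EuclideanSpace ℝ (Fin n)))) = v := hvK.csSup_eq
  have hone : 1 ≤ volume.real (convexHull ℝ (E : Set (EuclideanSpace ℝ (Fin n)))) / v := by
    rw [one_le_div hv0]
    obtain ⟨S, hS, rfl⟩ := hv.1
    exact measureReal_mono (convexHull_mono (Set.range_subset_iff.2 hS))
      (isBounded_convexHull.2 E.isCompact.isBounded).measure_lt_top.ne
  rw [hθ, hE, hEK]
  refine ⟨hr, hv, hvK, hv0, rfl, hone, ?_⟩
  obtain ⟨S, P, hP, rfl⟩ := hr.1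
  have hmono := legendre_strictMonoOn n hn
  -- Both sides lie in `[1, ∞)`, so they may be compared after applying `χₙ`; `P` attains the
  -- minimum `theta E`.
  refine (hmono.le_iff_le ((legendre_bijOn n hn).surjOn.mapsTo_invFunOn hone) hP.one_le_norm).1 ?_
  refine ((legendreInv_invOn n hn).2 hone).trans_le ?_
  rw [div_le_iff₀ hv0, mul_comm]
  refine hP.volume_convexHull_le.trans ?_
  have h1 : 1 ≤ (legendre n).eval ‖P‖ := (legendre_bijOn n hn).mapsTo hP.one_le_norm
  gcongr
  exact hle _ hP.1
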